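/- Let $G=(S,T,E)$ be a finite bipartite graph with vertex set $V=S\cup T$ ($S$ and $T$ disjoint, every edge joining $S$ to $T$). For a matching $M$ of $G$ let $V(M)$ be the set of vertices covered by $M$, and let $B(M)=V(M)\,\Delta\,S$ (symmetric difference). Let $M$ be a uniformly random element of the set of all matchings of $G$ (including the empty matching). Then the random set $B(M)\subseteq V$ is negatively associated, in the following sense. An event is a family $\mathcal{A}\subseteq 2^V$; it is increasing (decreasing) if it is closed under taking supersets (subsets) in $V$, and it depends only on $V_0\subseteq V$ if $A\in\mathcal{A}$ and $A\cap V_0=C\cap V_0$ imply $C\in\mathcal{A}$, for all $A,C\subseteq V$. Let $\mathcal{A},\mathcal{B}\subseteq 2^V$ be events depending only on $V_1$ and $V_2$ respectively, where $V_1,V_2\subseteq V$ are disjoint. If $\mathcal{A}$ and $\mathcal{B}$ are both increasing or both decreasing, then \[\mathbb{P}(B(M)\in\mathcal{A}\cap\mathcal{B})\le\mathbb{P}(B(M)\in\mathcal{A})\,\mathbb{P}(B(M)\in\mathcal{B}).\] If one of $\mathcal{A},\mathcal{B}$ is increasing and the other is decreasing, then \[\mathbb{P}(B(M)\in\mathcal{A}\cap\mathcal{B})\ge\mathbb{P}(B(M)\in\mathcal{A})\,\mathbb{P}(B(M)\in\mathcal{B}).\]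 -/

import Mathlib

/-!
Two independent uniform matchings `M₁`, `M₂` may be exchanged on any set of components of `M₁ ∪ M₂`
without changing their joint law. Such a component is a path, a cycle or a single vertex. The sets
`B(M₁)` and `B(M₂)` differ in it only at the ends of a path, and they meet it in equally many
vertices, because exchanging the endpoints of the edges of `M` carries `S` to `B(M)`. So at most one
vertex of a component leaves `B(M₁)`, and at most one enters it, when the matchings are exchanged
there: an exchange that changes both `B(M₁) ∩ V₁` and `B(M₁) ∩ V₂` moves them in opposite
directions. Averaging over all exchanges shows that `B(M₁) ∩ V₁` is less correlated with
`B(M₁) ∩ V₂` than with the independent set `B(M₂) ∩ V₂`.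
-/

open scoped ENNReal

namespace RandomMatching

variable {V : Type*}

/-- The matchings of `G`, the empty matching included. `Subgraph.IsMatching` requires every vertex
of the subgraph to have exactly one neighbour in it, so such a subgraph is determined by its edge
set and its vertex set is the set of vertices covered by these edges. -/
abbrev Matching (G : SimpleGraph V) : Type _ := {M : G.Subgraph // M.IsMatching}

instance (G : SimpleGraph V) : Nonempty (Matching G) :=
  ⟨⟨⊥, fun _ hv => hv.elim⟩⟩

noncomputable instance [Finite V] (G : SimpleGraph V) : Fintype (Matching G) :=
  Fintype.ofFinite _

/-- `B(M) = V(M) Δ S`, where `V(M)` is the set of vertices covered by `M`. -/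
def B {G : SimpleGraph V} (S : Set V) (M : Matching G) : Set V :=
  symmDiff M.1.verts S

/-- The law of the random set `B(M)`, for `M` a uniform random matching of `G`. -/
noncomputable def lawB [Finite V] (G : SimpleGraph V) (S : Set V) : PMF (Set V) :=
  (PMF.uniformOfFintype (Matching G)).map (B S)

/-- `ℙ(B(M) ∈ 𝒜)`, for `M` a uniform random matching of `G`. -/
noncomputable def prob [Finite V] (G : SimpleGraph V) (S : Set V) (𝒜 : Set (Set V)) : ℝ≥0∞ :=
  (lawB G S).toOuterMeasure 𝒜

/-- The event `𝒜` depends only on `V₀`. -/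
def DependsOnlyOn (𝒜 : Set (Set V)) (V₀ : Set V) : Prop :=
  ∀ A C : Set V, A ∩ V₀ = C ∩ V₀ → A ∈ 𝒜 → C ∈ 𝒜

end RandomMatching

namespace RandomMatching

section Exchange

variable {K R : Type*}

theorem sum_powerset_mul_le_sum_powerset_mul_sdiff [DecidableEq K] [Semiring R] [PartialOrder R]
    [IsOrderedAddMonoid R] (s : Finset K) (f g : Finset K → R)
    (h : ∀ k ∈ s, ∀ t u, f t * g u + f (insert k t) * g (insert k u) ≤
      f t * g (insert k u) + f (insert k t) * g u) :
    ∑ t ∈ s.powerset, f t * g t ≤ ∑ t ∈ s.powerset, f t * g (s \ t) := by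
  induction s using Finset.induction_on generalizing f g with
  | empty => simp
  | insert k s hk ih =>
    have without_k := ih f g fun j hj => h j (Finset.mem_insert_of_mem hj)
    have with_k := ih (fun t => f (insert k t)) (fun t => g (insert k t)) fun j hj t u => by
      simpa only [Finset.insert_comm k j] using
        h j (Finset.mem_insert_of_mem hj) (insert k t) (insert k u)
    rw [Finset.sum_powerset_insert hk, Finset.sum_powerset_insert hk]
    calc (∑ t ∈ s.powerset, f t * g t) + ∑ t ∈ s.powerset, f (insert k t) * g (insert k t)
      _ ≤ (∑ t ∈ s.powerset, f t * g (s \ t)) +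
            ∑ t ∈ s.powerset, f (insert k t) * g (insert k (s \ t)) := add_le_add without_k with_k
      _ ≤ (∑ t ∈ s.powerset, f t * g (insert k (s \ t))) +
            ∑ t ∈ s.powerset, f (insert k t) * g (s \ t) := by
          simp only [← Finset.sum_add_distrib]
          exact Finset.sum_le_sum fun t _ => h k (Finset.mem_insert_self k s) t (s \ t)
      _ = (∑ t ∈ s.powerset, f t * g (insert k s \ t)) +
            ∑ t ∈ s.powerset, f (insert k t) * g (insert k s \ insert k t) := by
          congr 1 <;> refine Finset.sum_congr rfl fun t ht => ?_
          · rw [Finset.insert_sdiff_of_notMem _ fun hkt => hk (Finset.mem_powerset.1 ht hkt)]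
          · rw [Finset.insert_sdiff_insert, Finset.sdiff_insert_of_notMem hk]

variable {V : Type*} {X Y V₁ V₂ : Set V} {c : V → K}

theorem ite_inter_subset_ite_inter {P Q W : Set V} (hX : Disjoint ((X \ Y) ∩ (P \ Q)) W)
    (hY : Disjoint ((Y \ X) ∩ (Q \ P)) W) : P.ite X Y ∩ W ⊆ Q.ite X Y ∩ W := by
  intro v
  have hXv : v ∈ (X \ Y) ∩ (P \ Q) → v ∉ W := fun hv => Set.disjoint_left.1 hX hv
  have hYv : v ∈ (Y \ X) ∩ (Q \ P) → v ∉ W := fun hv => Set.disjoint_left.1 hY hv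
  simp only [Set.ite, Set.mem_inter_iff, Set.mem_union, Set.mem_sdiff] at hXv hYv ⊢
  tauto

theorem ite_preimage_insert_inter_subset {k : K} {t : Set K} {W : Set V}
    (h : Disjoint ((X \ Y) ∩ c ⁻¹' {k}) W) :
    (c ⁻¹' insert k t).ite X Y ∩ W ⊆ (c ⁻¹' t).ite X Y ∩ W := by
  refine ite_inter_subset_ite_inter (h.mono_left ?_) ?_
  · exact Set.inter_subset_inter_right _ fun v hv => hv.1.resolve_right hv.2
  · simp [Set.sdiff_eq_empty.2 (Set.preimage_mono (f := c) (Set.subset_insert k t))]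

theorem ite_preimage_inter_subset_insert {k : K} {t : Set K} {W : Set V}
    (h : Disjoint ((Y \ X) ∩ c ⁻¹' {k}) W) :
    (c ⁻¹' t).ite X Y ∩ W ⊆ (c ⁻¹' insert k t).ite X Y ∩ W := by
  refine ite_inter_subset_ite_inter ?_ (h.mono_left ?_)
  · simp [Set.sdiff_eq_empty.2 (Set.preimage_mono (f := c) (Set.subset_insert k t))]
  · exact Set.inter_subset_inter_right _ fun v hv => hv.1.resolve_right hv.2

theorem disjoint_or_disjoint_of_subsingleton {D : Set V} (hD : D.Subsingleton)
    (hdisj : Disjoint V₁ V₂) : Disjoint D V₁ ∨ Disjoint D V₂ := by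
  obtain rfl | ⟨v, rfl⟩ := hD.eq_empty_or_singleton
  · exact Or.inl (Set.empty_disjoint V₁)
  · simp only [Set.disjoint_singleton_left]
    exact not_and_or.1 fun hv => Set.disjoint_left.1 hdisj hv.1 hv.2

variable [Semiring R] [PartialOrder R] [IsStrictOrderedRing R] [ExistsAddOfLE R] {f g : Set V → R}

theorem ite_preimage_mul_add_mul_insert_le (hdisj : Disjoint V₁ V₂) (hf : Monotone f)
    (hg : Monotone g) {k : K}
    (hXY : ((X \ Y) ∩ c ⁻¹' {k}).Subsingleton) (hYX : ((Y \ X) ∩ c ⁻¹' {k}).Subsingleton)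
    (t u : Set K) :
    f ((c ⁻¹' t).ite X Y ∩ V₁) * g ((c ⁻¹' u).ite X Y ∩ V₂) +
        f ((c ⁻¹' insert k t).ite X Y ∩ V₁) * g ((c ⁻¹' insert k u).ite X Y ∩ V₂) ≤
      f ((c ⁻¹' t).ite X Y ∩ V₁) * g ((c ⁻¹' insert k u).ite X Y ∩ V₂) +
        f ((c ⁻¹' insert k t).ite X Y ∩ V₁) * g ((c ⁻¹' u).ite X Y ∩ V₂) := by
  rcases disjoint_or_disjoint_of_subsingleton hXY hdisj with hX | hX <;>
    rcases disjoint_or_disjoint_of_subsingleton hYX hdisj with hY | hY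
  · rw [(ite_preimage_insert_inter_subset hX).antisymm (ite_preimage_inter_subset_insert hY),
      add_comm]
  · exact mul_add_mul_le_mul_add_mul' (hf (ite_preimage_insert_inter_subset hX))
      (hg (ite_preimage_inter_subset_insert hY))
  · exact mul_add_mul_le_mul_add_mul (hf (ite_preimage_inter_subset_insert hY))
      (hg (ite_preimage_insert_inter_subset hX))
  · rw [(ite_preimage_insert_inter_subset hX).antisymm (ite_preimage_inter_subset_insert hY)]

theorem sum_ite_preimage_mul_le [Fintype K] (hdisj : Disjoint V₁ V₂) (hf : Monotone f)
    (hg : Monotone g) (hXY : ∀ k, ((X \ Y) ∩ c ⁻¹' {k}).Subsingleton)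
    (hYX : ∀ k, ((Y \ X) ∩ c ⁻¹' {k}).Subsingleton) :
    ∑ t : Finset K, f ((c ⁻¹' t).ite X Y ∩ V₁) * g ((c ⁻¹' t).ite X Y ∩ V₂) ≤
      ∑ t : Finset K, f ((c ⁻¹' t).ite X Y ∩ V₁) * g ((c ⁻¹' t).ite Y X ∩ V₂) := by
  classical
  have key := sum_powerset_mul_le_sum_powerset_mul_sdiff Finset.univ
    (fun t : Finset K => f ((c ⁻¹' t).ite X Y ∩ V₁))
    (fun t : Finset K => g ((c ⁻¹' t).ite X Y ∩ V₂)) fun k _ t u => by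
      simpa only [Finset.coe_insert] using
        ite_preimage_mul_add_mul_insert_le hdisj hf hg (hXY k) (hYX k) t u
  simpa only [Finset.powerset_univ, ← Finset.compl_eq_univ_sdiff, Finset.coe_compl,
    Set.preimage_compl, Set.ite_compl] using key

theorem sum_le_sum_of_forall_sum_perm_le {α ι M : Type*} [Fintype α] [Fintype ι] [Nonempty ι]
    [AddCommMonoid M] [LinearOrder M] [IsOrderedCancelAddMonoid M] {F F' : α → M}
    (e : ι → Equiv.Perm α) (h : ∀ a, ∑ i, F (e i a) ≤ ∑ i, F' (e i a)) :
    ∑ a, F a ≤ ∑ a, F' a := by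
  have average (H : α → M) : ∑ a, ∑ i, H (e i a) = Fintype.card ι • ∑ a, H a := by
    rw [Finset.sum_comm]
    simp_rw [Equiv.sum_comp]
    rw [Finset.sum_const, Finset.card_univ]
  refine le_of_nsmul_le_nsmul_right (Fintype.card_ne_zero (α := ι)) ?_
  rw [← average, ← average]
  exact Finset.sum_le_sum fun a _ => h a

end Exchange

section DegreeAtMostTwo

variable {V : Type*} [Fintype V] (H : SimpleGraph V) [DecidableRel H.Adj]

theorem card_degree_le_one_le_two (hconn : H.Connected) (hdeg : ∀ v, H.degree v ≤ 2) :
    (Finset.univ.filter fun v => H.degree v ≤ 1).card ≤ 2 := by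
  classical
  have edges : Fintype.card V ≤ H.edgeFinset.card + 1 := by
    simpa [SimpleGraph.edgeFinset_card, Nat.card_eq_fintype_card] using
      hconn.card_vert_le_card_edgeSet_add_one
  have degrees : ∑ v, (H.degree v + if H.degree v ≤ 1 then 1 else 0) ≤ ∑ _v : V, 2 :=
    Finset.sum_le_sum fun v _ => by
      have := hdeg v
      split_ifs <;> omega
  rw [Finset.sum_add_distrib, H.sum_degrees_eq_twice_card_edges, Finset.sum_boole,
    Finset.sum_const, Finset.card_univ, smul_eq_mul, Nat.cast_id] at degrees
  omega

theorem ncard_supp_degree_le_one_le_two (hdeg : ∀ v, H.degree v ≤ 2) (C : H.ConnectedComponent) :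
    (C.supp ∩ {v | H.degree v ≤ 1}).ncard ≤ 2 := by
  classical
  have degree_eq (v : C.supp) : (H.induce C.supp).degree v = H.degree v :=
    SimpleGraph.degree_induce_of_neighborSet_subset fun _ hw => C.mem_supp_of_adj_mem_supp v.2 hw
  have key := card_degree_le_one_le_two (H.induce C.supp) C.connected_toSimpleGraph fun v =>
    (degree_eq v).trans_le (hdeg v)
  simp only [degree_eq] at key
  rw [← Subtype.image_preimage_coe, Set.ncard_image_of_injective _ Subtype.val_injective,
    Set.ncard_eq_toFinset_card']
  convert key using 2
  ext v
  simp

end DegreeAtMostTwo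

section Matchings

variable {V : Type*} {G : SimpleGraph V} {S T : Set V}

open scoped Classical in
/-- The vertex matched to `v` by `M`, or `v` itself if `M` does not cover `v`. -/
noncomputable def partner (M : Matching G) (v : V) : V :=
  if hv : v ∈ M.1.verts then (M.2 hv).choose else v

theorem adj_partner (M : Matching G) {v : V} (hv : v ∈ M.1.verts) : M.1.Adj v (partner M v) := by
  rw [partner, dif_pos hv]
  exact (M.2 hv).choose_spec.1

theorem partner_of_notMem (M : Matching G) {v : V} (hv : v ∉ M.1.verts) : partner M v = v :=
  dif_neg hv

theorem partner_involutive (M : Matching G) : Function.Involutive (partner M) := by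
  intro v
  by_cases hv : v ∈ M.1.verts
  · have hadj := adj_partner M hv
    exact M.2.eq_of_adj_left (adj_partner M hadj.snd_mem) hadj.symm
  · rw [partner_of_notMem M hv, partner_of_notMem M hv]

theorem preimage_partner (hG : G.IsBipartiteWith S T) (M : Matching G) :
    partner M ⁻¹' S = B S M := by
  ext v
  rw [Set.mem_preimage, B, Set.mem_symmDiff]
  by_cases hv : v ∈ M.1.verts
  · have hadj := (adj_partner M hv).adj_sub
    have sides : v ∈ S ↔ partner M v ∉ S := by
      rcases hG.mem_of_adj hadj with ⟨hvS, hwT⟩ | ⟨hvT, hwS⟩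
      · exact iff_of_true hvS (Set.disjoint_right.1 hG.disjoint hwT)
      · exact iff_of_false (Set.disjoint_right.1 hG.disjoint hvT) (not_not_intro hwS)
    tauto
  · rw [partner_of_notMem M hv]
    tauto

theorem ncard_B_inter (hG : G.IsBipartiteWith S T) (M : Matching G) {C : Set V}
    (hC : ∀ ⦃v w⦄, M.1.Adj v w → (v ∈ C ↔ w ∈ C)) : (B S M ∩ C).ncard = (S ∩ C).ncard := by
  have preimage_C : partner M ⁻¹' C = C := by
    ext v
    by_cases hv : v ∈ M.1.verts
    · exact (hC (adj_partner M hv)).symm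
    · rw [Set.mem_preimage, partner_of_notMem M hv]
  have hbij := (partner_involutive M).bijective
  rw [← preimage_partner hG M]
  nth_rw 1 [← preimage_C]
  rw [← Set.preimage_inter, Set.ncard, Set.ncard, Set.encard_preimage_of_bijective hbij]

theorem encard_neighborSet_le_one (M : Matching G) (v : V) : (M.1.neighborSet v).encard ≤ 1 :=
  Set.encard_le_one_iff.2 fun _ _ hw hu => M.2.eq_of_adj_left hw hu

theorem encard_neighborSet_of_notMem (M : Matching G) {v : V} (hv : v ∉ M.1.verts) :
    (M.1.neighborSet v).encard = 0 :=
  Set.encard_eq_zero.2 (Set.eq_empty_of_forall_notMem fun _ hw => hv hw.fst_mem)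

end Matchings

section UnionGraph

variable {V : Type*} {G : SimpleGraph V} {S T : Set V}

/-- The graph `M₁ ∪ M₂` on all of `V`. -/
def unionGraph (M₁ M₂ : Matching G) : SimpleGraph V :=
  M₁.1.spanningCoe ⊔ M₂.1.spanningCoe

theorem unionGraph_comm (M₁ M₂ : Matching G) : unionGraph M₁ M₂ = unionGraph M₂ M₁ :=
  sup_comm _ _

theorem degree_unionGraph_le (M₁ M₂ : Matching G) (v : V)
    [Fintype ((unionGraph M₁ M₂).neighborSet v)] :
    (unionGraph M₁ M₂).degree v ≤ (M₁.1.neighborSet v).encard + (M₂.1.neighborSet v).encard := by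
  rw [SimpleGraph.degree, SimpleGraph.neighborFinset, ← Set.encard_eq_coe_toFinset_card]
  exact Set.encard_union_le _ _

theorem degree_unionGraph_le_two (M₁ M₂ : Matching G) (v : V)
    [Fintype ((unionGraph M₁ M₂).neighborSet v)] : (unionGraph M₁ M₂).degree v ≤ 2 :=
  mod_cast (degree_unionGraph_le M₁ M₂ v).trans
    (add_le_add (encard_neighborSet_le_one M₁ v) (encard_neighborSet_le_one M₂ v))

theorem degree_unionGraph_le_one (M₁ M₂ : Matching G) {v : V}
    [Fintype ((unionGraph M₁ M₂).neighborSet v)] (hv : v ∈ symmDiff M₁.1.verts M₂.1.verts) :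
    (unionGraph M₁ M₂).degree v ≤ 1 := by
  have key := degree_unionGraph_le M₁ M₂ v
  rcases hv with ⟨-, hv⟩ | ⟨-, hv⟩
  · rw [encard_neighborSet_of_notMem _ hv, add_zero] at key
    exact_mod_cast key.trans (encard_neighborSet_le_one M₁ v)
  · rw [encard_neighborSet_of_notMem _ hv, zero_add] at key
    exact_mod_cast key.trans (encard_neighborSet_le_one M₂ v)

theorem symmDiff_B (S : Set V) (M₁ M₂ : Matching G) :
    symmDiff (B S M₁) (B S M₂) = symmDiff M₁.1.verts M₂.1.verts := by
  rw [B, B, symmDiff_symmDiff_symmDiff_comm, symmDiff_self, symmDiff_bot]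

theorem subsingleton_B_sdiff_inter_supp [Finite V] (hG : G.IsBipartiteWith S T)
    (M₁ M₂ : Matching G) (C : (unionGraph M₁ M₂).ConnectedComponent) :
    ((B S M₁ \ B S M₂) ∩ C.supp).Subsingleton := by
  classical
  cases nonempty_fintype V
  have ncard_eq : ((B S M₁ \ B S M₂) ∩ C.supp).ncard = ((B S M₂ \ B S M₁) ∩ C.supp).ncard := by
    rw [Set.inter_sdiff_distrib_right, Set.inter_sdiff_distrib_right,
      ← Set.ncard_eq_ncard_iff_ncard_sdiff_eq_ncard_sdiff,
      ncard_B_inter hG M₁ fun _ _ h => C.mem_supp_congr_adj (Or.inl h),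
      ncard_B_inter hG M₂ fun _ _ h => C.mem_supp_congr_adj (Or.inr h)]
  have ncard_add_le : ((B S M₁ \ B S M₂) ∩ C.supp).ncard +
      ((B S M₂ \ B S M₁) ∩ C.supp).ncard ≤ 2 := by
    have disjoint : Disjoint ((B S M₁ \ B S M₂) ∩ C.supp) ((B S M₂ \ B S M₁) ∩ C.supp) :=
      disjoint_sdiff_sdiff.mono Set.inter_subset_left Set.inter_subset_left
    rw [← Set.ncard_union_eq disjoint, ← Set.union_inter_distrib_right, ← Set.symmDiff_def,
      symmDiff_B, Set.inter_comm]
    refine (Set.ncard_le_ncard ?_).trans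
      (ncard_supp_degree_le_one_le_two _ (fun v => degree_unionGraph_le_two M₁ M₂ v) C)
    exact Set.inter_subset_inter_right _ fun v hv => degree_unionGraph_le_one M₁ M₂ hv
  rw [← Set.ncard_le_one_iff_subsingleton]
  omega

end UnionGraph

section Splice

variable {V : Type*} {G : SimpleGraph V} {S T : Set V}

/-- A vertex representing the component of `v` in `H`. Labelling the components of all graphs on
`V` by elements of the one type `V` allows one set of labels to be used for every pair of
matchings. -/
noncomputable def componentRep (H : SimpleGraph V) (v : V) : V :=
  (H.connectedComponentMk v).out

theorem componentRep_eq_of_adj {H : SimpleGraph V} {v w : V} (h : H.Adj v w) :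
    componentRep H v = componentRep H w :=
  congrArg Quot.out (SimpleGraph.ConnectedComponent.connectedComponentMk_eq_of_adj h)

theorem preimage_componentRep_singleton_subset (H : SimpleGraph V) (k : V) :
    componentRep H ⁻¹' {k} ⊆ (H.connectedComponentMk k).supp := by
  rintro v rfl
  exact (Quot.out_eq (H.connectedComponentMk v)).symm

/-- The matching that agrees with `M₁` on the components of `M₁ ∪ M₂` whose label lies in `t`, and
with `M₂` on the others. -/
def splice (t : Set V) (M₁ M₂ : Matching G) : Matching G where
  val :=
    { verts := (componentRep (unionGraph M₁ M₂) ⁻¹' t).ite M₁.1.verts M₂.1.verts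
      Adj v w := componentRep (unionGraph M₁ M₂) v ∈ t ∧ M₁.1.Adj v w ∨
        componentRep (unionGraph M₁ M₂) v ∉ t ∧ M₂.1.Adj v w
      adj_sub := by
        rintro v w (⟨-, h⟩ | ⟨-, h⟩) <;> exact h.adj_sub
      edge_vert := by
        rintro v w (⟨hv, h⟩ | ⟨hv, h⟩)
        · exact Or.inl ⟨h.fst_mem, hv⟩
        · exact Or.inr ⟨h.fst_mem, hv⟩
      symm := .mk <| by
        rintro v w (⟨hv, h⟩ | ⟨hv, h⟩)
        · exact Or.inl ⟨componentRep_eq_of_adj (H := unionGraph M₁ M₂) (Or.inl h) ▸ hv, h.symm⟩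
        · exact Or.inr ⟨componentRep_eq_of_adj (H := unionGraph M₁ M₂) (Or.inr h) ▸ hv, h.symm⟩ }
  property := by
    rintro v (⟨hv, ht⟩ | ⟨hv, ht⟩)
    · obtain ⟨w, hw, huniq⟩ := M₁.2 hv
      exact ⟨w, Or.inl ⟨ht, hw⟩, fun u hu => huniq u (hu.resolve_right fun h => h.1 ht).2⟩
    · obtain ⟨w, hw, huniq⟩ := M₂.2 hv
      exact ⟨w, Or.inr ⟨ht, hw⟩, fun u hu => huniq u (hu.resolve_left fun h => ht h.1).2⟩

theorem mem_verts_splice {t : Set V} {M₁ M₂ : Matching G} {v : V} :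
    v ∈ (splice t M₁ M₂).1.verts ↔
      v ∈ (componentRep (unionGraph M₁ M₂) ⁻¹' t).ite M₁.1.verts M₂.1.verts :=
  Iff.rfl

theorem splice_adj {t : Set V} {M₁ M₂ : Matching G} {v w : V} :
    (splice t M₁ M₂).1.Adj v w ↔ componentRep (unionGraph M₁ M₂) v ∈ t ∧ M₁.1.Adj v w ∨
      componentRep (unionGraph M₁ M₂) v ∉ t ∧ M₂.1.Adj v w :=
  Iff.rfl

theorem B_splice (t : Set V) (M₁ M₂ : Matching G) :
    B S (splice t M₁ M₂) = (componentRep (unionGraph M₁ M₂) ⁻¹' t).ite (B S M₁) (B S M₂) := by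
  ext v
  simp only [B, Set.mem_symmDiff, mem_verts_splice, Set.ite, Set.mem_union, Set.mem_inter_iff,
    Set.mem_sdiff]
  tauto

theorem unionGraph_splice (t : Set V) (M₁ M₂ : Matching G) :
    unionGraph (splice t M₁ M₂) (splice t M₂ M₁) = unionGraph M₁ M₂ := by
  ext v w
  change (splice t M₁ M₂).1.Adj v w ∨ (splice t M₂ M₁).1.Adj v w ↔ M₁.1.Adj v w ∨ M₂.1.Adj v w
  rw [splice_adj, splice_adj, unionGraph_comm M₂ M₁]
  tauto

theorem splice_splice (t : Set V) (M₁ M₂ : Matching G) :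
    splice t (splice t M₁ M₂) (splice t M₂ M₁) = M₁ := by
  refine Subtype.ext (SimpleGraph.Subgraph.ext ?_ ?_)
  · ext v
    simp only [mem_verts_splice, unionGraph_splice, unionGraph_comm M₂ M₁, Set.ite, Set.mem_union,
      Set.mem_inter_iff, Set.mem_sdiff]
    tauto
  · ext v w
    simp only [splice_adj, unionGraph_splice, unionGraph_comm M₂ M₁]
    tauto

/-- The involution of the pairs of matchings that exchanges `M₁` and `M₂` on the components of
`M₁ ∪ M₂` whose label lies outside `t`. -/
def splicePerm (G : SimpleGraph V) (t : Set V) : Equiv.Perm (Matching G × Matching G) :=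
  Function.Involutive.toPerm (fun p => (splice t p.1 p.2, splice t p.2 p.1)) fun p =>
    Prod.ext (splice_splice t p.1 p.2) (splice_splice t p.2 p.1)

theorem splicePerm_apply (t : Set V) (p : Matching G × Matching G) :
    splicePerm G t p = (splice t p.1 p.2, splice t p.2 p.1) :=
  rfl

theorem sum_B_splice_mul_le {R : Type*} [Semiring R] [PartialOrder R] [IsStrictOrderedRing R]
    [ExistsAddOfLE R] [Fintype V] (hG : G.IsBipartiteWith S T) {V₁ V₂ : Set V}
    (hdisj : Disjoint V₁ V₂) {f g : Set V → R} (hf : Monotone f) (hg : Monotone g)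
    (M₁ M₂ : Matching G) :
    ∑ t : Finset V, f (B S (splice t M₁ M₂) ∩ V₁) * g (B S (splice t M₁ M₂) ∩ V₂) ≤
      ∑ t : Finset V, f (B S (splice t M₁ M₂) ∩ V₁) * g (B S (splice t M₂ M₁) ∩ V₂) := by
  have subsingleton_fibre (M₁ M₂ : Matching G) (k : V) :
      ((B S M₁ \ B S M₂) ∩ componentRep (unionGraph M₁ M₂) ⁻¹' {k}).Subsingleton :=
    (subsingleton_B_sdiff_inter_supp hG M₁ M₂ _).anti
      (Set.inter_subset_inter_right _ (preimage_componentRep_singleton_subset _ k))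
  simp only [B_splice, unionGraph_comm M₂ M₁]
  exact sum_ite_preimage_mul_le hdisj hf hg (subsingleton_fibre M₁ M₂)
    (unionGraph_comm M₂ M₁ ▸ subsingleton_fibre M₂ M₁)

theorem card_mul_sum_B_mul_le {R : Type*} [Semiring R] [LinearOrder R] [IsStrictOrderedRing R]
    [ExistsAddOfLE R] [Finite V] (hG : G.IsBipartiteWith S T) {V₁ V₂ : Set V}
    (hdisj : Disjoint V₁ V₂) {f g : Set V → R} (hf : Monotone f) (hg : Monotone g) :
    Fintype.card (Matching G) * ∑ M : Matching G, f (B S M ∩ V₁) * g (B S M ∩ V₂) ≤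
      (∑ M : Matching G, f (B S M ∩ V₁)) * ∑ M : Matching G, g (B S M ∩ V₂) := by
  cases nonempty_fintype V
  have key := sum_le_sum_of_forall_sum_perm_le (fun t : Finset V => splicePerm G (t : Set V))
    (F := fun p => f (B S p.1 ∩ V₁) * g (B S p.1 ∩ V₂))
    (F' := fun p => f (B S p.1 ∩ V₁) * g (B S p.2 ∩ V₂)) fun p => by
      simpa only [splicePerm_apply] using sum_B_splice_mul_le hG hdisj hf hg p.1 p.2
  rw [Finset.sum_mul_sum, Finset.mul_sum]
  simpa only [Fintype.sum_prod_type, Finset.sum_const, Finset.card_univ, nsmul_eq_mul] using key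

end Splice

section Events

theorem measure_inter_compl_le_iff {Ω : Type*} [MeasurableSpace Ω] (μ : MeasureTheory.Measure Ω)
    [MeasureTheory.IsProbabilityMeasure μ] (s : Set Ω) {t : Set Ω} (ht : MeasurableSet t) :
    μ (s ∩ tᶜ) ≤ μ s * μ tᶜ ↔ μ s * μ t ≤ μ (s ∩ t) := by
  have total : μ (s ∩ t) + μ (s ∩ tᶜ) = μ s * μ t + μ s * μ tᶜ := by
    rw [← mul_add, MeasureTheory.prob_add_prob_compl ht, mul_one, ← Set.sdiff_eq,
      MeasureTheory.measure_inter_add_sdiff s ht]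
  constructor <;> intro h <;> by_contra! hlt
  · exact (ENNReal.add_lt_add_of_lt_of_le (by finiteness) hlt h).ne total
  · exact (ENNReal.add_lt_add_of_le_of_lt (by finiteness) h hlt).ne total.symm

theorem monotone_indicator_one {α R : Type*} [Preorder α] [Preorder R] [Zero R] [One R]
    [ZeroLEOneClass R] {𝒜 : Set α} (h𝒜 : IsUpperSet 𝒜) : Monotone (𝒜.indicator (1 : α → R)) := by
  intro A C hAC
  by_cases hA : A ∈ 𝒜
  · rw [Set.indicator_of_mem hA, Set.indicator_of_mem (h𝒜 hAC hA)]
    rfl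
  · rw [Set.indicator_of_notMem hA]
    exact Set.indicator_nonneg (fun _ _ => zero_le_one) C

variable {V : Type*} {G : SimpleGraph V} {S T V₁ V₂ : Set V} {𝒜 ℬ : Set (Set V)}

theorem DependsOnlyOn.inter_mem_iff (h𝒜 : DependsOnlyOn 𝒜 V₁) (A : Set V) :
    A ∩ V₁ ∈ 𝒜 ↔ A ∈ 𝒜 := by
  have agree : A ∩ V₁ ∩ V₁ = A ∩ V₁ := Set.inter_eq_left.2 Set.inter_subset_right
  exact ⟨h𝒜 _ _ agree, h𝒜 _ _ agree.symm⟩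

theorem DependsOnlyOn.compl (h𝒜 : DependsOnlyOn 𝒜 V₁) : DependsOnlyOn 𝒜ᶜ V₁ :=
  fun A C hAC hA hC => hA (h𝒜 C A hAC.symm hC)

theorem DependsOnlyOn.indicator_inter {R : Type*} [Zero R] [One R] (h𝒜 : DependsOnlyOn 𝒜 V₁)
    (A : Set V) : 𝒜.indicator (1 : Set V → R) (A ∩ V₁) = 𝒜.indicator 1 A := by
  classical
  simp only [Set.indicator_apply, h𝒜.inter_mem_iff, Pi.one_apply]

variable [Finite V]

theorem prob_eq_sum_div (G : SimpleGraph V) (S : Set V) (𝒜 : Set (Set V)) :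
    prob G S 𝒜 =
      (∑ M : Matching G, 𝒜.indicator 1 (B S M) : ℕ) / (Fintype.card (Matching G) : ℝ≥0∞) := by
  classical
  rw [prob, lawB, PMF.toOuterMeasure_map_apply, PMF.toOuterMeasure_uniformOfFintype_apply]
  simp [Set.indicator_apply, Fintype.card_subtype]

theorem prob_inter_compl_le_iff (G : SimpleGraph V) (S : Set V) (𝒜 ℬ : Set (Set V)) :
    prob G S (𝒜 ∩ ℬᶜ) ≤ prob G S 𝒜 * prob G S ℬᶜ ↔
      prob G S 𝒜 * prob G S ℬ ≤ prob G S (𝒜 ∩ ℬ) := by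
  let _ : MeasurableSpace (Set V) := ⊤
  have toMeasure_eq (𝒞 : Set (Set V)) : (lawB G S).toMeasure 𝒞 = prob G S 𝒞 :=
    PMF.toMeasure_apply_eq_toOuterMeasure_apply _ trivial
  simpa only [toMeasure_eq] using measure_inter_compl_le_iff (lawB G S).toMeasure 𝒜 (t := ℬ) trivial

theorem prob_inter_le_of_isUpperSet (hG : G.IsBipartiteWith S T) (hdisj : Disjoint V₁ V₂)
    (h𝒜 : DependsOnlyOn 𝒜 V₁) (hℬ : DependsOnlyOn ℬ V₂) (h𝒜up : IsUpperSet 𝒜)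
    (hℬup : IsUpperSet ℬ) : prob G S (𝒜 ∩ ℬ) ≤ prob G S 𝒜 * prob G S ℬ := by
  have counts := card_mul_sum_B_mul_le (R := ℕ) hG hdisj (monotone_indicator_one h𝒜up)
    (monotone_indicator_one hℬup)
  have indicator_mul (A : Set V) :
      𝒜.indicator (1 : Set V → ℕ) A * ℬ.indicator 1 A = (𝒜 ∩ ℬ).indicator 1 A := by
    rw [Set.inter_indicator_one, Pi.mul_apply]
  simp only [h𝒜.indicator_inter, hℬ.indicator_inter, indicator_mul, Nat.cast_id] at counts
  have card_ne_zero : (Fintype.card (Matching G) : ℝ≥0∞) ≠ 0 :=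
    Nat.cast_ne_zero.2 Fintype.card_ne_zero
  rw [prob_eq_sum_div, prob_eq_sum_div, prob_eq_sum_div, ← ENNReal.mul_div_mul_left _ _
    card_ne_zero (ENNReal.natCast_ne_top _), ← ENNReal.mul_div_mul_comm]
  · exact ENNReal.div_le_div_right (mod_cast counts) _
  all_goals simp

theorem le_prob_inter_of_isUpperSet_of_isLowerSet (hG : G.IsBipartiteWith S T)
    (hdisj : Disjoint V₁ V₂) (h𝒜 : DependsOnlyOn 𝒜 V₁) (hℬ : DependsOnlyOn ℬ V₂)
    (h𝒜up : IsUpperSet 𝒜) (hℬlow : IsLowerSet ℬ) :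
    prob G S 𝒜 * prob G S ℬ ≤ prob G S (𝒜 ∩ ℬ) :=
  (prob_inter_compl_le_iff G S 𝒜 ℬ).1
    (prob_inter_le_of_isUpperSet hG hdisj h𝒜 hℬ.compl h𝒜up hℬlow.compl)

theorem prob_inter_le_of_isLowerSet (hG : G.IsBipartiteWith S T) (hdisj : Disjoint V₁ V₂)
    (h𝒜 : DependsOnlyOn 𝒜 V₁) (hℬ : DependsOnlyOn ℬ V₂) (h𝒜low : IsLowerSet 𝒜)
    (hℬlow : IsLowerSet ℬ) : prob G S (𝒜 ∩ ℬ) ≤ prob G S 𝒜 * prob G S ℬ := by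
  have mixed := le_prob_inter_of_isUpperSet_of_isLowerSet hG hdisj.symm hℬ.compl h𝒜 hℬlow.compl
    h𝒜low
  rw [mul_comm, Set.inter_comm, ← prob_inter_compl_le_iff, compl_compl] at mixed
  exact mixed

end Events

end RandomMatching

theorem mainTheorem4 {V : Type*} [Finite V] (G : SimpleGraph V) (S T : Set V)
    (hG : G.IsBipartiteWith S T) (hV : S ∪ T = Set.univ)
    (𝒜 ℬ : Set (Set V)) (V₁ V₂ : Set V) (hdisj : Disjoint V₁ V₂)
    (h𝒜 : RandomMatching.DependsOnlyOn 𝒜 V₁) (hℬ : RandomMatching.DependsOnlyOn ℬ V₂) :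
    ((IsUpperSet 𝒜 ∧ IsUpperSet ℬ) ∨ (IsLowerSet 𝒜 ∧ IsLowerSet ℬ) →
      RandomMatching.prob G S (𝒜 ∩ ℬ) ≤ RandomMatching.prob G S 𝒜 * RandomMatching.prob G S ℬ) ∧
    ((IsUpperSet 𝒜 ∧ IsLowerSet ℬ) ∨ (IsLowerSet 𝒜 ∧ IsUpperSet ℬ) →
      RandomMatching.prob G S 𝒜 * RandomMatching.prob G S ℬ ≤ RandomMatching.prob G S (𝒜 ∩ ℬ)) := by
  constructor
  · rintro (⟨h𝒜up, hℬup⟩ | ⟨h𝒜low, hℬlow⟩)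
    · exact RandomMatching.prob_inter_le_of_isUpperSet hG hdisj h𝒜 hℬ h𝒜up hℬup
    · exact RandomMatching.prob_inter_le_of_isLowerSet hG hdisj h𝒜 hℬ h𝒜low hℬlow
  · rintro (⟨h𝒜up, hℬlow⟩ | ⟨h𝒜low, hℬup⟩)
    · exact RandomMatching.le_prob_inter_of_isUpperSet_of_isLowerSet hG hdisj h𝒜 hℬ h𝒜up hℬlow
    · rw [mul_comm, Set.inter_comm]
      exact RandomMatching.le_prob_inter_of_isUpperSet_of_isLowerSet hG hdisj.symm hℬ h𝒜 hℬup h𝒜low
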